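/- Let $V$ be a real reflexive Banach space with dual $V^*$, let $|\cdot|$ be a lower semicontinuous seminorm on $V$ with kernel $Y=\{y\in V: |y|=0\}$, and let $A:V\to V^*$ be linear and semicoercive: for some $c_0>0$, $\langle Av,v\rangle\ge c_0|v|^2$ for all $v\in V$. Let $g\in V^*$, let $K\subseteq V$ be closed and convex with $0\in K$, and let $c>0$. For a convex set $C\ni 0$, call $\psi:C\times C\to\mathbb R$ *admissible on $C$* if: (a) $\psi$ is pseudomonotone, i.e. whenever $u_n\rightharpoonup u$ in $C$ (sequences) and $\liminf_n\psi(u_n,u)\ge 0$, then $\limsup_n\psi(u_n,v)\le\psi(u,v)$ for all $v\in C$; (b) for each $v\in C$, $\psi(\cdot,v)$ is upper semicontinuous on the intersection of $C$ with any finite-dimensional subspace of $V$; (c) $\psi(v,0)\le c\|v\|$ for all $v\in C$. Let $\varphi$ be admissible on $K$ with $\varphi(u,u)=0$ for all $u\in K$. The problem $VI(A,\psi,g,C)$ is: find $u\in C$ with $\langle Au,v-u\rangle+\psi(u,v)\ge\langle g,v-u\rangle$ for all $v\in C$. Assume: (A1$^s$) every sequence with $|v_n|\to0$, $v_n\rightharpoonup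 v$ and $\|v_n\|\ge\eta$ for some $\eta>0$ has a subsequence converging to $v$ in norm; (A2$^s$) either (i) $Y\cap K$ is bounded, or (iii) $\langle g,y\rangle<-c$ for all $y\in Y\cap K$ with $\|y\|=1$, with the same constant $c$ as above. Let $T$ be a nonempty directed set and, for $t\in T$, let $K_t$ be a closed convex subset, containing $0$, of a finite-dimensional subspace $V_t$ of $V$, and let $\varphi_t:K_t\times K_t\to\mathbb R$. Assume: (H1) if, for a subnet $\{K_{t'}\}_{t'\in T'}$ of $\{K_t\}_{t\in T}$, $v_{t'}\in K_{t'}$ and $v_{t'}\rightharpoonup v$ in $V$, then $v\in K$; (H2) for each $v\in K$ there are $v_t\in K_t$ ($t\in T$) with $v_t\to v$ in $V$; (H3) for each $t\in T$, $\varphi_t$ is admissible on $K_t$ (with the same constant $c$); (H4) for every subnet $\{K_{t'}\}_{t'\in T'}$ of $\{K_t\}_{t\in T}$ and all nets $u_{t'},v_{t'}\in K_{t'}$ with $u_{t'}\rightharpoonup u$ and $v_{t'}\to v$ in $V$, $\limsup_{t'\in T'}\varphi_{t'}(u_{t'},v_{t'})\le\varphi(u,v)$. Then: 1. If $\varphi_t(u,\cdot)$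 is convex on $K_t$ and $\varphi_t(u,u)=0$ for all $t\in T$ and $u\in K_t$, then there is $t_0\in T$ such that $VI(A,\varphi_t,g,K_t)$ has a solution for every $t\ge t_0$. 2. There are $t_0\in T$ and $R\ge0$ such that for every $t\ge t_0$ every solution $u_t$ of $VI(A,\varphi_t,g,K_t)$ satisfies $\|u_t\|\le R$. 3. For every family $\{u_t\}_{t\in T}$ in $V$ such that $u_t$ solves $VI(A,\varphi_t,g,K_t)$ for all sufficiently large $t$, there are a subnet $\{u_{t'}\}_{t'\in T'}$ and a solution $u$ of $VI(A,\varphi,g,K)$ such that $u_{t'}\rightharpoonup u$ in $V$ and $\lim_{t'\in T'}|u_{t'}-u|=0$. -/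

import Mathlib

open Filter Topology

universe u v

/-- Reflexivity of a normed space: the canonical embedding `V → V**` is onto. -/
def IsReflexiveSpace (V : Type v) [NormedAddCommGroup V] [NormedSpace ℝ V] : Prop :=
  Function.Surjective (NormedSpace.inclusionInDoubleDual ℝ V)

/-- Convergence of `x` to `a` along the filter `l` in the weak topology of `V`. -/
def WeakTendsto {V : Type v} [NormedAddCommGroup V] [NormedSpace ℝ V] {ι : Type*}
    (x : ι → V) (l : Filter ι) (a : V) : Prop :=
  Tendsto (fun i => toWeakSpace ℝ V (x i)) l (𝓝 (toWeakSpace ℝ V a))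

section

variable {V : Type v} [NormedAddCommGroup V] [NormedSpace ℝ V]

/-- `A : V → V*` is semicoercive with respect to the seminorm `p`:
`⟨A v, v⟩ ≥ c₀ p(v)²` for some `c₀ > 0` and all `v`. -/
def IsSemicoercive (p : Seminorm ℝ V) (A : V →ₗ[ℝ] StrongDual ℝ V) : Prop :=
  ∃ c₀ : ℝ, 0 < c₀ ∧ ∀ w : V, c₀ * p w ^ 2 ≤ A w w

/-- The kernel `Y` of the seminorm `p`. -/
def seminormKer (p : Seminorm ℝ V) : Set V := {y | p y = 0}

/-- Pseudomonotonicity of a bifunction on `K × K`: if `uₙ ⇀ u` in `K` and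
`liminf φ(uₙ, u) ≥ 0`, then `limsup φ(uₙ, w) ≤ φ(u, w)` for all `w ∈ K`.
Lower and upper limits are taken in the extended reals. -/
def IsPseudomonotoneOn (K : Set V) (φ : V → V → ℝ) : Prop :=
  ∀ (x : ℕ → V) (a : V), (∀ n, x n ∈ K) → a ∈ K → WeakTendsto x atTop a →
    0 ≤ liminf (fun n => ((φ (x n) a : ℝ) : EReal)) atTop →
    ∀ w ∈ K, limsup (fun n => ((φ (x n) w : ℝ) : EReal)) atTop ≤ ((φ a w : ℝ) : EReal)

/-- For every `w ∈ K`, `φ(·, w)` is upper semicontinuous on the intersection of `K` with any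
finite-dimensional subspace. -/
def IsFinDimUSCOn (K : Set V) (φ : V → V → ℝ) : Prop :=
  ∀ w ∈ K, ∀ F : Submodule ℝ V, FiniteDimensional ℝ F →
    UpperSemicontinuousOn (fun a => φ a w) (K ∩ (F : Set V))

/-- The standing conditions on a bifunction over `K`, with growth constant `c`:
pseudomonotonicity, upper semicontinuity in the first variable on finite-dimensional sections,
and `φ(a, 0) ≤ c ‖a‖`. -/
structure IsAdmissibleBifunction (K : Set V) (φ : V → V → ℝ) (c : ℝ) : Prop where
  pseudomonotone : IsPseudomonotoneOn K φ
  usc : IsFinDimUSCOn K φ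
  growth : ∀ a ∈ K, φ a 0 ≤ c * ‖a‖

/-- `a` solves the variational inequality `VI(A, φ, g, K)`. -/
def IsVISolution (A : V →ₗ[ℝ] StrongDual ℝ V) (φ : V → V → ℝ) (g : StrongDual ℝ V)
    (K : Set V) (a : V) : Prop :=
  a ∈ K ∧ ∀ w ∈ K, g (w - a) ≤ A a (w - a) + φ a w

/-- Every sequence with `p(xₙ) → 0`, `xₙ ⇀ a` and `‖xₙ‖ ≥ η > 0` has a subsequence that
converges to `a` in norm. -/
def SeminormCompactness (p : Seminorm ℝ V) : Prop :=
  ∀ (x : ℕ → V) (a : V), Tendsto (fun n => p (x n)) atTop (𝓝 0) → WeakTendsto x atTop a →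
    (∃ η : ℝ, 0 < η ∧ ∀ n, η ≤ ‖x n‖) →
    ∃ k : ℕ → ℕ, StrictMono k ∧ Tendsto (fun n => x (k n)) atTop (𝓝 a)

/-- Either `Y ∩ K` is bounded, or `⟨g, y⟩ < -c` for all `y ∈ Y ∩ K` of norm one. -/
def RecessionCondition (p : Seminorm ℝ V) (K : Set V) (g : StrongDual ℝ V) (c : ℝ) : Prop :=
  Bornology.IsBounded (seminormKer p ∩ K) ∨
    ∀ y ∈ seminormKer p ∩ K, ‖y‖ = 1 → g y < -c

/-- First half of Mosco convergence: weak limits of nets `x_s ∈ K_{h(s)}`, for a subnet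
`(K_{h(s)})` of `(K_t)`, lie in `K`. A subnet is given by a map `h : T' → T` of directed sets that
tends to infinity. (Directed sets in the universe of `T` suffice here.) -/
def MoscoLimsup {T : Type u} [Preorder T] (Kt : T → Set V) (K : Set V) : Prop :=
  ∀ (T' : Type u) [Preorder T'] [IsDirectedOrder T'] [Nonempty T'] (h : T' → T),
    Tendsto h atTop atTop → ∀ (x : T' → V) (a : V), (∀ s, x s ∈ Kt (h s)) →
    WeakTendsto x atTop a → a ∈ K

/-- Second half of Mosco convergence: every point of `K` is the norm limit of a net
`w_t ∈ K_t`. -/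
def MoscoLiminf {T : Type u} [Preorder T] (Kt : T → Set V) (K : Set V) : Prop :=
  ∀ a ∈ K, ∃ w : T → V, (∀ t, w t ∈ Kt t) ∧ Tendsto w atTop (𝓝 a)

/-- Upper limit condition on the approximate bifunctions `φ_t`: along every subnet
`h : T' → T`, if `x_s, y_s ∈ K_{h(s)}`, `x_s ⇀ a` and `y_s → b` in norm, then
`limsup φ_{h(s)}(x_s, y_s) ≤ φ(a, b)`, the upper limit being taken in the extended reals. -/
def BifunctionLimsup {T : Type u} [Preorder T] (Kt : T → Set V) (φt : T → V → V → ℝ)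
    (φ : V → V → ℝ) : Prop :=
  ∀ (T' : Type u) [Preorder T'] [IsDirectedOrder T'] [Nonempty T'] (h : T' → T),
    Tendsto h atTop atTop → ∀ (x y : T' → V) (a b : V),
    (∀ s, x s ∈ Kt (h s)) → (∀ s, y s ∈ Kt (h s)) →
    WeakTendsto x atTop a → Tendsto y atTop (𝓝 b) →
    limsup (fun s => ((φt (h s) (x s) (y s) : ℝ) : EReal)) atTop ≤ ((φ a b : ℝ) : EReal)

end

/-!
Testing the inequality with `0` gives `⟨A a, a⟩ ≤ ⟨g, a⟩ + c ‖a‖` for every solution `a`, and this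
estimate alone is uniformly bounded on `K_t` for large `t` (`exists_norm_le_of_apply_self_le`).
Otherwise semicoercivity forces `p → 0` along the normalized points. The compactness condition on
`p` then yields a norm limit: a unit vector `y` with `p y = 0` and `⟨g, y⟩ ≥ -c` whose ray lies in
`K` by the first half of Mosco convergence. Either alternative of the recession condition excludes
this. The compactness condition speaks of sequences while the family is a net; the passage is by
total boundedness of the sets `{‖y‖ ≤ R, p y ≤ 1 / (n + 1)}` and completeness
(`SeminormCompactness.exists_tendsto_ultrafilter`).

Existence for a single `t` follows by solving on `K_t` intersected with a ball of radius larger than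
the bound, where the solution is interior to the ball, hence a solution on `K_t`
(`exists_isVISolution_of_finiteDimensional`). On compact convex sets this is Ky Fan's inequality
(`exists_forall_nonneg_of_convexOn`), deduced from Brouwer's fixed point theorem on a simplex by a
partition of unity. Brouwer's theorem is proved from Scarf's combinatorial lemma
(`exists_dominant_image_eq_univ`), a parity count on dominant subsets of a grid.

For convergence, bounded families converge weakly along ultrafilters by reflexivity. A positive
linear operator on a Banach space is bounded, and `a ↦ ⟨A a, a⟩` is convex, so one can pass to the
limit in the inequality directly (`isVISolution_of_weakTendsto`); testing with approximations of the
limit itself gives `⟨A (x_t - a), x_t - a⟩ → 0`, hence convergence in `p`. All limits are taken along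
filters, and `exists_net_map_atTop_eq` translates between filters and subnets.
-/

/-! ### Scarf's lemma on dominant sets -/

section Scarf

variable {ι Z : Type*} (r : ι → Z → ℤ)

/-- A finite set `σ` is dominant for the family of rankings `r` if no `x` is ranked strictly above
the `r i`-minimum of `σ` for all `i` at once. -/
def IsDominant (σ : Finset Z) : Prop := ∀ x, ∃ i, ∀ s ∈ σ, r i x ≤ r i s

variable {r}

lemma IsDominant.mono {σ τ : Finset Z} (h : IsDominant r σ) (hτ : τ ⊆ σ) : IsDominant r τ :=
  fun x => (h x).imp fun _ hi s hs => hi s (hτ hs)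

variable [Fintype ι] [DecidableEq ι] [DecidableEq Z]

/-- In a set of as many elements as colours that misses a colour, the elements whose removal leaves
precisely the colours other than `k` come in a pair (those of the one repeated colour). -/
lemma even_card_erase_image_eq (c : Z → ι) (k : ι) {σ : Finset Z}
    (hcard : σ.card = Fintype.card ι) (hσ : σ.image c ≠ Finset.univ) :
    Even (σ.filter fun x => (σ.erase x).image c = Finset.univ.erase k).card := by
  rcases (σ.filter fun x => (σ.erase x).image c = Finset.univ.erase k).eq_empty_or_nonempty
    with h | ⟨x, hx⟩
  · simp [h]
  obtain ⟨hxσ, hx⟩ := Finset.mem_filter.1 hx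
  have hck : c x ≠ k := by
    rintro rfl
    apply hσ
    rw [← Finset.insert_erase hxσ, Finset.image_insert, hx, Finset.insert_erase (Finset.mem_univ _)]
  obtain ⟨y, hy, hyx⟩ := Finset.mem_image.1
    (hx ▸ Finset.mem_erase.2 ⟨hck, Finset.mem_univ _⟩ : c x ∈ (σ.erase x).image c)
  have hinj : Set.InjOn c (σ.erase x) := by
    rw [← Finset.card_image_iff, hx, Finset.card_erase_of_mem (Finset.mem_univ _),
      Finset.card_erase_of_mem hxσ, Finset.card_univ, hcard]
  obtain ⟨hyne, hyσ⟩ := Finset.mem_erase.1 hy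
  suffices h : (σ.filter fun x => (σ.erase x).image c = Finset.univ.erase k) = {x, y} by
    rw [h, Finset.card_pair hyne.symm]
    exact even_two
  have himg : ∀ z ∈ σ, c z ≠ k := by
    intro z hz hzk
    by_cases hzx : z = x
    · exact hck (hzx ▸ hzk)
    · have : c z ∈ (σ.erase x).image c :=
        Finset.mem_image_of_mem c (Finset.mem_erase.2 ⟨hzx, hz⟩)
      rw [hx] at this
      exact (Finset.mem_erase.1 this).1 hzk
  ext z
  simp only [Finset.mem_filter, Finset.mem_insert, Finset.mem_singleton]
  constructor
  · rintro ⟨hzσ, hz⟩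
    by_contra! hne
    have hzx : z ∈ σ.erase x := Finset.mem_erase.2 ⟨hne.1, hzσ⟩
    have hcz : c z ∈ (σ.erase z).image c := by
      rw [hz]; exact Finset.mem_erase.2 ⟨himg z hzσ, Finset.mem_univ _⟩
    obtain ⟨w, hw, hwz⟩ := Finset.mem_image.1 hcz
    obtain ⟨hwne, hwσ⟩ := Finset.mem_erase.1 hw
    by_cases hwx : w = x
    · subst hwx
      exact hne.2 (hinj hzx hy (hwz.symm.trans hyx.symm))
    · exact hwne (hinj (Finset.mem_erase.2 ⟨hwx, hwσ⟩) hzx hwz)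
  · rintro (rfl | rfl)
    · exact ⟨hxσ, hx⟩
    · refine ⟨hyσ, ?_⟩
      rw [← hx]
      ext i
      simp only [Finset.mem_image, Finset.mem_erase]
      constructor
      · rintro ⟨w, ⟨hw, hwσ⟩, rfl⟩
        by_cases hwx : w = x
        · exact ⟨z, ⟨hyne, hyσ⟩, hwx ▸ hyx⟩
        · exact ⟨w, ⟨hwx, hwσ⟩, rfl⟩
      · rintro ⟨w, ⟨hw, hwσ⟩, rfl⟩
        by_cases hwy : w = z
        · exact ⟨x, ⟨hyne.symm, hxσ⟩, hwy ▸ hyx.symm⟩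
        · exact ⟨w, ⟨hwy, hwσ⟩, rfl⟩

variable [Fintype Z]

open Classical in
/-- A dominant set `τ` with one element fewer than there are rankings has exactly two rankings `a`,
`b` sharing their minimum. It extends to a dominant set by one element for each of `a`, `b` for
which some `x` lies above the minima of all the other rankings. -/
lemma IsDominant.card_extensions (hr : ∀ i, Function.Injective (r i)) {τ : Finset Z}
    (hτ : IsDominant r τ) (hne : τ.Nonempty) (hcard : τ.card + 1 = Fintype.card ι) :
    ∃ (m : ι → Z) (a b : ι), (∀ i, m i ∈ τ) ∧ (∀ i, ∀ s ∈ τ, r i (m i) ≤ r i s) ∧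
      a ≠ b ∧ m a = m b ∧
      (Finset.univ.filter fun x => x ∉ τ ∧ IsDominant r (insert x τ)).card =
        (if ∃ x, ∀ j ≠ a, r j (m j) < r j x then 1 else 0) +
        (if ∃ x, ∀ j ≠ b, r j (m j) < r j x then 1 else 0) := by
  have hm : ∀ i, ∃ s ∈ τ, ∀ s' ∈ τ, r i s ≤ r i s' := fun i => τ.exists_min_image (r i) hne
  choose m hmτ hmin using hm
  obtain ⟨a, -, b, -, hab, hmab⟩ := Finset.exists_ne_map_eq_of_card_lt_of_maps_to
    (s := Finset.univ) (t := τ) (f := m) (by rw [Finset.card_univ]; omega) (by simp [Set.MapsTo, hmτ])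
  have hsurj : ∀ s ∈ τ, ∃ i, m i = s := fun s hs => by
    obtain ⟨i, hi⟩ := hτ s
    exact ⟨i, hr i (le_antisymm (hmin i s hs) (hi _ (hmτ i)))⟩
  -- if the indices other than `k` already attain every element of `τ`, they do so injectively
  have hinj : ∀ k, (∀ s ∈ τ, ∃ i ≠ k, m i = s) → ∀ i ≠ k, ∀ j ≠ k, m i = m j → i = j := by
    intro k hk i hi j hj hij
    have := Finset.injOn_of_surjOn_of_card_le (s := Finset.univ.erase k) (t := τ) m
      (by intro i _; exact hmτ i)
      (by intro s hs
          obtain ⟨i, hi, rfl⟩ := hk s hs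
          exact ⟨i, by simpa using hi, rfl⟩)
      (by rw [Finset.card_erase_of_mem (Finset.mem_univ k), Finset.card_univ]; omega)
    exact this (by simpa using hi) (by simpa using hj) hij
  have hsurj' : ∀ k, k = a ∨ k = b → ∀ s ∈ τ, ∃ i ≠ k, m i = s := by
    intro k hk s hs
    obtain ⟨i, hi⟩ := hsurj s hs
    by_cases hik : i = k
    · subst hik
      rcases hk with rfl | rfl
      · exact ⟨b, hab.symm, hmab ▸ hi⟩
      · exact ⟨a, hab, hmab ▸ hi⟩
    · exact ⟨i, hik, hi⟩
  -- the candidates replacing `m k` as the minimum for the ranking `k`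
  let M : ι → Z → Prop := fun k x => ∀ j ≠ k, r j (m j) < r j x
  let R : ι → Finset Z := fun k => Finset.univ.filter fun x => M k x ∧ ∀ y, M k y → r k y ≤ r k x
  have hR : ∀ k, (R k).card = if ∃ x, M k x then 1 else 0 := by
    intro k
    split_ifs with h
    · obtain ⟨x, hx⟩ := h
      obtain ⟨z, hz, hzmax⟩ := (Finset.univ.filter (M k)).exists_max_image (r k)
        ⟨x, by simpa using hx⟩
      rw [Finset.card_eq_one]
      refine ⟨z, Finset.eq_singleton_iff_unique_mem.2 ⟨?_, ?_⟩⟩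
      · simp only [R, Finset.mem_filter, Finset.mem_univ, true_and] at hz ⊢
        exact ⟨hz, fun y hy => hzmax y (by simpa using hy)⟩
      · intro y hy
        simp only [R, Finset.mem_filter, Finset.mem_univ, true_and] at hy hz
        exact hr k (le_antisymm (hzmax y (by simpa using hy.1)) (hy.2 z hz))
    · rw [Finset.card_eq_zero, Finset.eq_empty_iff_forall_notMem]
      intro x hx
      simp only [R, Finset.mem_filter, Finset.mem_univ, true_and] at hx
      exact h ⟨x, hx.1⟩
  refine ⟨m, a, b, hmτ, hmin, hab, hmab, ?_⟩
  rw [← hR a, ← hR b, ← Finset.card_union_of_disjoint]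
  · congr 1
    ext x
    simp only [R, Finset.mem_filter, Finset.mem_univ, true_and, Finset.mem_union]
    constructor
    · rintro ⟨hx, hd⟩
      obtain ⟨k, hk⟩ := hd x
      have hkx : r k x < r k (m k) := lt_of_le_of_ne (hk _ (Finset.mem_insert_of_mem (hmτ k)))
        fun h => hx (hr k h ▸ hmτ k)
      have key : ∀ s ∈ τ, ∃ i ≠ k, m i = s ∧ r i s < r i x := by
        intro s hs
        obtain ⟨i, hi⟩ := hd s
        have his : m i = s :=
          hr i (le_antisymm (hmin i s hs) (hi _ (Finset.mem_insert_of_mem (hmτ i))))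
        have hisx : r i s < r i x := lt_of_le_of_ne (hi _ (Finset.mem_insert_self _ _))
          fun h => hx (hr i h ▸ hs)
        refine ⟨i, ?_, his, hisx⟩
        rintro rfl
        rw [← his] at hisx
        exact lt_asymm hisx hkx
      have hkinj := hinj k fun s hs => let ⟨i, h1, h2, _⟩ := key s hs; ⟨i, h1, h2⟩
      have hMk : M k x := by
        intro j hj
        obtain ⟨i, hi, hij, hlt⟩ := key (m j) (hmτ j)
        rwa [hkinj i hi j hj hij] at hlt
      have hmax : ∀ y, M k y → r k y ≤ r k x := by
        intro y hy
        obtain ⟨i, hi⟩ := hd y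
        by_cases hik : i = k
        · exact hik ▸ hi x (Finset.mem_insert_self _ _)
        · exact absurd (hi _ (Finset.mem_insert_of_mem (hmτ i))) (not_le.2 (hy i hik))
      by_cases hka : k = a
      · exact Or.inl (hka ▸ ⟨hMk, hmax⟩)
      · by_cases hkb : k = b
        · exact Or.inr (hkb ▸ ⟨hMk, hmax⟩)
        · exact absurd (hkinj a (Ne.symm hka) b (Ne.symm hkb) hmab) hab
    · have key : ∀ k, k = a ∨ k = b → (M k x ∧ ∀ y, M k y → r k y ≤ r k x) →
          x ∉ τ ∧ IsDominant r (insert x τ) := by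
        rintro k hk ⟨hMx, hmax⟩
        constructor
        · intro hx
          obtain ⟨i, hi, rfl⟩ := hsurj' k hk x hx
          exact lt_irrefl _ (hMx i hi)
        · have hkx : ∀ s ∈ τ, r k x ≤ r k s := by
            obtain ⟨i, hi⟩ := hτ x
            by_cases hik : i = k
            · exact hik ▸ hi
            · exact absurd (hi _ (hmτ i)) (not_le.2 (hMx i hik))
          intro y
          by_cases hy : M k y
          · refine ⟨k, fun s hs => ?_⟩
            rcases Finset.mem_insert.1 hs with rfl | hs
            · exact hmax y hy
            · exact (hmax y hy).trans (hkx s hs)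
          · simp only [M, not_forall, not_lt] at hy
            obtain ⟨j, hj, hle⟩ := hy
            refine ⟨j, fun s hs => ?_⟩
            rcases Finset.mem_insert.1 hs with rfl | hs
            · exact hle.trans (hMx j hj).le
            · exact hle.trans (hmin j s hs)
      rintro (h | h)
      · exact key a (Or.inl rfl) h
      · exact key b (Or.inr rfl) h
  · rw [Finset.disjoint_left]
    intro x hxa hxb
    simp only [R, Finset.mem_filter, Finset.mem_univ, true_and] at hxa hxb
    obtain ⟨i, hi⟩ := hτ x
    by_cases hia : i = a
    · exact absurd (hi _ (hmτ i)) (not_le.2 (hxb.1 i (hia ▸ hab)))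
    · exact absurd (hi _ (hmτ i)) (not_le.2 (hxa.1 i hia))

open Classical in
/-- **Scarf's lemma.** The points `s i` are slack points: `s i` is lowest in the ranking `i`, and in
every other ranking it lies above all points that are not slack. If the slack point `s i` has colour
`i`, then some dominant set carries all colours. -/
theorem exists_dominant_image_eq_univ [Nontrivial ι] (hr : ∀ i, Function.Injective (r i))
    (s : ι → Z) (hs_low : ∀ i z, z ≠ s i → r i (s i) < r i z)
    (hs_high : ∀ i j z, j ≠ i → z ∉ Set.range s → r i z < r i (s j))
    (c : Z → ι) (hc : ∀ i, c (s i) = i) :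
    ∃ σ : Finset Z, IsDominant r σ ∧ σ.image c = Finset.univ := by
  by_contra! hno
  obtain ⟨k⟩ : Nonempty ι := inferInstance
  have hs_inj : Function.Injective s := Function.LeftInverse.injective hc
  -- the facets coloured by everything but `k`, and their extensions
  let D : Finset (Finset Z) :=
    Finset.univ.filter fun τ => IsDominant r τ ∧ τ.card + 1 = Fintype.card ι ∧
      τ.image c = Finset.univ.erase k
  let R : Finset Z → Finset Z := fun τ =>
    Finset.univ.filter fun x => x ∉ τ ∧ IsDominant r (insert x τ)
  let P : Finset (Σ _ : Finset Z, Z) := D.sigma R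
  have hcardι : 1 < Fintype.card ι := Fintype.one_lt_card
  -- counted by facets, the incidences are odd in number: one facet lies on the boundary
  let τ₀ : Finset Z := (Finset.univ.erase k).image s
  have hτ₀D : τ₀ ∈ D := by
    simp only [D, Finset.mem_filter, Finset.mem_univ, true_and]
    refine ⟨?_, ?_, ?_⟩
    · intro x
      by_cases hx : ∃ j, j ≠ k ∧ s j = x
      · obtain ⟨j, -, rfl⟩ := hx
        refine ⟨j, fun z _ => ?_⟩
        by_cases hz : z = s j
        · rw [hz]
        · exact (hs_low j z hz).le
      · refine ⟨k, fun z hz => ?_⟩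
        obtain ⟨j, hj, rfl⟩ := Finset.mem_image.1 hz
        have hjk := (Finset.mem_erase.1 hj).1
        by_cases hxk : x = s k
        · rw [hxk]
          exact (hs_low k _ fun h => hjk (hs_inj h)).le
        · refine (hs_high k j x hjk ?_).le
          rintro ⟨i, rfl⟩
          exact hx ⟨i, fun h => hxk (by rw [h]), rfl⟩
    · rw [Finset.card_image_of_injective _ hs_inj, Finset.card_erase_of_mem (Finset.mem_univ _),
        Finset.card_univ]
      omega
    · ext i
      simp [τ₀, hc]
  have hne : ∀ τ ∈ D, τ.Nonempty := by
    intro τ hτ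
    simp only [D, Finset.mem_filter, Finset.mem_univ, true_and] at hτ
    rw [← Finset.card_pos]; omega
  have hodd₀ : (R τ₀).card = 1 := by
    have hD := hτ₀D
    simp only [D, Finset.mem_filter, Finset.mem_univ, true_and] at hD
    obtain ⟨m, a, b, hmτ, hmin, hab, hmab, hcard⟩ :=
      hD.1.card_extensions hr (hne _ hτ₀D) hD.2.1
    have hm : ∀ j ≠ k, m j = s j := by
      intro j hj
      by_contra h
      exact absurd (hmin j (s j) (Finset.mem_image_of_mem s (by simpa using hj)))
        (not_le.2 (hs_low j _ h))
    have hpos : ∃ x, ∀ j ≠ k, r j (m j) < r j x :=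
      ⟨s k, fun j hj => by
        rw [hm j hj]; exact hs_low j _ fun h => hj (hs_inj h).symm⟩
    have hneg : ∀ l ≠ k, m k = m l → ¬ ∃ x, ∀ j ≠ l, r j (m j) < r j x := by
      rintro l hl hkl ⟨x, hx⟩
      have hxk := hx k hl.symm
      rw [hkl, hm l hl] at hxk
      by_cases hxs : x ∈ Set.range s
      · obtain ⟨i, rfl⟩ := hxs
        by_cases hil : i = l
        · rw [hil] at hxk; exact lt_irrefl _ hxk
        · by_cases hik : i = k
          · subst hik
            exact lt_asymm hxk (hs_low i _ fun h => hl (hs_inj h))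
          · have := hx i hil
            rw [hm i hik] at this
            exact lt_irrefl _ this
      · exact lt_asymm hxk (hs_high k l x hl hxs)
    change (R τ₀).card = _ at hcard
    by_cases hak : a = k
    · subst hak
      rw [hcard, if_pos hpos, if_neg (hneg b hab.symm hmab)]
    · by_cases hbk : b = k
      · subst hbk
        rw [hcard, if_pos hpos, if_neg (hneg a hab hmab.symm)]
      · rw [hm a hak, hm b hbk] at hmab
        exact absurd (hs_inj hmab) hab
  have htwo : ∀ τ ∈ D, τ ≠ τ₀ → (R τ).card = 2 := by
    intro τ hτ hτne
    have hD := hτ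
    simp only [D, Finset.mem_filter, Finset.mem_univ, true_and] at hD
    obtain ⟨m, a, b, hmτ, hmin, hab, hmab, hcard⟩ := hD.1.card_extensions hr (hne _ hτ) hD.2.1
    have hz : ∃ z ∈ τ, z ∉ Set.range s := by
      by_contra! hall
      apply hτne
      ext z
      simp only [τ₀, Finset.mem_image, Finset.mem_erase, Finset.mem_univ, and_true]
      constructor
      · intro hz
        obtain ⟨i, rfl⟩ := hall z hz
        refine ⟨i, ?_, rfl⟩
        have := Finset.mem_image_of_mem c hz
        rw [hD.2.2, hc] at this
        exact (Finset.mem_erase.1 this).1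
      · rintro ⟨i, hi, rfl⟩
        have : i ∈ τ.image c := by rw [hD.2.2]; simpa using hi
        obtain ⟨w, hw, hwi⟩ := Finset.mem_image.1 this
        obtain ⟨j, rfl⟩ := hall w hw
        rw [hc] at hwi
        exact hwi ▸ hw
    obtain ⟨z, hzτ, hzs⟩ := hz
    have hpos : ∀ l, ∃ x, ∀ j ≠ l, r j (m j) < r j x := fun l =>
      ⟨s l, fun j hj => (hmin j z hzτ).trans_lt (hs_high j l z hj.symm hzs)⟩
    change (R τ).card = _ at hcard
    rw [hcard, if_pos (hpos a), if_pos (hpos b)]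
  have hPodd : Odd P.card := by
    rw [Finset.card_sigma, ← Finset.add_sum_erase _ _ hτ₀D, hodd₀]
    refine Odd.add_even odd_one (Finset.even_sum _ fun τ hτ => ?_)
    obtain ⟨h1, h2⟩ := Finset.mem_erase.1 hτ
    rw [htwo τ h2 h1]
    exact even_two
  -- counted by full sets, they are even in number
  have hPeven : Even P.card := by
    rw [Finset.card_eq_sum_card_fiberwise (f := fun q : Σ _ : Finset Z, Z => insert q.2 q.1)
      (t := Finset.univ) (by simp [Set.MapsTo])]
    refine Finset.even_sum _ fun σ _ => ?_
    by_cases hσ : IsDominant r σ ∧ σ.card = Fintype.card ι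
    · have := even_card_erase_image_eq c k hσ.2 (hno σ hσ.1)
      suffices h : (P.filter fun q => insert q.2 q.1 = σ).card =
          (σ.filter fun x => (σ.erase x).image c = Finset.univ.erase k).card by rwa [h]
      refine Finset.card_bij' (fun q _ => q.2) (fun x _ => ⟨σ.erase x, x⟩) ?_ ?_ ?_ ?_
      · rintro ⟨τ, x⟩ hq
        simp only [P, D, R, Finset.mem_filter, Finset.mem_sigma, Finset.mem_univ, true_and] at hq
        obtain ⟨⟨⟨h1, h2, h3⟩, h4, h5⟩, rfl⟩ := hq
        simp [h4, h3]
      · intro x hx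
        obtain ⟨hxσ, hx⟩ := Finset.mem_filter.1 hx
        simp only [P, D, R, Finset.mem_filter, Finset.mem_sigma, Finset.mem_univ, true_and]
        rw [Finset.insert_erase hxσ]
        refine ⟨⟨⟨hσ.1.mono (Finset.erase_subset _ _), ?_, hx⟩, by simp, hσ.1⟩, rfl⟩
        rw [Finset.card_erase_of_mem hxσ, hσ.2]
        omega
      · rintro ⟨τ, x⟩ hq
        simp only [P, D, R, Finset.mem_filter, Finset.mem_sigma, Finset.mem_univ, true_and] at hq
        obtain ⟨⟨-, h4, -⟩, rfl⟩ := hq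
        simp [h4]
      · intro x hx
        rfl
    · suffices h : (P.filter fun q => insert q.2 q.1 = σ).card = 0 by
        rw [h]
        exact Even.zero
      rw [Finset.card_eq_zero, Finset.eq_empty_iff_forall_notMem]
      rintro ⟨τ, x⟩ hq
      simp only [P, D, R, Finset.mem_filter, Finset.mem_sigma, Finset.mem_univ, true_and] at hq
      obtain ⟨⟨⟨h1, h2, h3⟩, h4, h5⟩, rfl⟩ := hq
      exact hσ ⟨h5, by rw [Finset.card_insert_of_notMem h4, h2]⟩
  exact Nat.not_even_iff_odd.2 hPodd hPeven

end Scarf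

/-! ### Brouwer's theorem on the standard simplex -/

section Brouwer

variable {ι : Type*} [Fintype ι]

/-- The vectors with natural coordinates of sum `N` are the points of a grid in a simplex. Any
colouring of the grid by its coordinates admits a grid point `s` such that for every coordinate `i`
that is not small at `s`, the colour `i` occurs near `s`. -/
lemma exists_grid_point_near_colours [Nontrivial ι] (N : ℕ) (c : (ι → ℕ) → ι) :
    ∃ s : ι → ℕ, ∑ i, s i = N ∧ ∀ i, s i ≤ Fintype.card ι ∨
      ∃ s' : ι → ℕ, ∑ i, s' i = N ∧ (∀ j, |(s' j : ℤ) - s j| ≤ Fintype.card ι) ∧ c s' = i := by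
  classical
  obtain ⟨k⟩ : Nonempty ι := inferInstance
  let X := {x : ι → ℕ // x ∈ Finset.piAntidiag Finset.univ N}
  let _ : Fintype X := Finset.Subtype.fintype _
  have hXsum : ∀ x : X, ∑ i, x.1 i = N := fun x => (Finset.mem_piAntidiag.1 x.2).1
  have hXle : ∀ (x : X) i, x.1 i ≤ N := fun x i => by
    exact (Finset.single_le_sum (fun _ _ => Nat.zero_le _) (Finset.mem_univ i)).trans_eq (hXsum x)
  -- grid points and slack points, ranked by coordinates, ties being broken by an enumeration
  let val : X ⊕ ι → ι → ℤ :=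
    Sum.elim (fun x i => (x.1 i : ℤ)) (fun j i => if i = j then -1 else N + 1)
  let e := Fintype.equivFin (X ⊕ ι)
  let r : ι → X ⊕ ι → ℤ := fun i z => val z i * Fintype.card (X ⊕ ι) + (e z : ℕ)
  have hr_lt : ∀ i z w, val z i < val w i → r i z < r i w := by
    intro i z w h
    have h1 := (e z).2
    simp only [r]
    have h3 : (val z i + 1) * Fintype.card (X ⊕ ι) ≤ val w i * Fintype.card (X ⊕ ι) :=
      mul_le_mul_of_nonneg_right (by omega) (by positivity)
    have h4 : ((e z : ℕ) : ℤ) < Fintype.card (X ⊕ ι) := by exact_mod_cast h1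
    linarith [Int.natCast_nonneg (e w : ℕ)]
  have hr : ∀ i, Function.Injective (r i) := by
    intro i z w h
    have hv : val z i = val w i := le_antisymm
      (not_lt.1 fun hlt => (hr_lt i w z hlt).ne' h) (not_lt.1 fun hlt => (hr_lt i z w hlt).ne h)
    simp only [r, hv, add_right_inj, Nat.cast_inj] at h
    exact e.injective (Fin.ext h)
  have hlow : ∀ i z, z ≠ Sum.inr i → r i (Sum.inr i) < r i z := by
    intro i z hz
    apply hr_lt
    rcases z with x | j
    · simp only [val, Sum.elim_inl, Sum.elim_inr, if_pos]
      omega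
    · have : i ≠ j := fun h => hz (by rw [h])
      simp only [val, Sum.elim_inr, if_pos, if_neg this]
      omega
  obtain ⟨σ, hσ, hσc⟩ := exists_dominant_image_eq_univ hr Sum.inr hlow
    (by
      rintro i j (x | l) hji hz
      · apply hr_lt
        have := hXle x i
        simp only [val, Sum.elim_inl, Sum.elim_inr, if_neg hji.symm]
        omega
      · exact absurd ⟨l, rfl⟩ hz)
    (Sum.elim (fun x => c x.1) id) (fun i => rfl)
  have hcol : ∀ i, Sum.inr i ∉ σ → ∃ x : X, Sum.inl x ∈ σ ∧ c x.1 = i := by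
    intro i hi
    obtain ⟨z, hz, hzi⟩ := Finset.mem_image.1 (hσc ▸ Finset.mem_univ i)
    rcases z with x | j
    · exact ⟨x, hz, hzi⟩
    · simp only [Sum.elim_inr, id] at hzi
      exact absurd (hzi ▸ hz) hi
  -- a grid point cannot be dominated through a coordinate whose slack point lies in `σ`
  have hdom : ∀ x : X, ∃ i, Sum.inr i ∉ σ ∧ ∀ s : X, Sum.inl s ∈ σ → x.1 i ≤ s.1 i := by
    intro x
    obtain ⟨i, hi⟩ := hσ (Sum.inl x)
    refine ⟨i, fun h => absurd (hi _ h) (not_le.2 (hlow i _ (by simp))), fun s hs => ?_⟩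
    by_contra! hlt
    exact absurd (hi _ hs) (not_le.2 (hr_lt i _ _ (by simpa [val] using hlt)))
  let x₀ : X := ⟨Pi.single k N, by simp [Finset.mem_piAntidiag]⟩
  obtain ⟨i₀, hi₀, -⟩ := hdom x₀
  obtain ⟨s₀, hs₀, -⟩ := hcol i₀ hi₀
  have hm : ∀ i, ∃ s : X, Sum.inl s ∈ σ ∧ ∀ s' : X, Sum.inl s' ∈ σ → s.1 i ≤ s'.1 i := by
    intro i
    obtain ⟨s, hs, hs'⟩ := (Finset.univ.filter fun s : X => Sum.inl s ∈ σ).exists_min_image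
      (fun s => s.1 i) ⟨s₀, by simpa using hs₀⟩
    exact ⟨s, by simpa using hs, fun s' h => hs' s' (by simpa using h)⟩
  choose m hmσ hm using hm
  let C : Finset ι := Finset.univ.filter fun i => Sum.inr i ∉ σ
  have hsum : N < ∑ i ∈ C, ((m i).1 i + 1) := by
    by_contra! hle
    -- a grid point above all minima would violate dominance
    let x : ι → ℕ := fun i => (if i ∈ C then (m i).1 i + 1 else 0) +
      Pi.single (M := fun _ => ℕ) k (N - ∑ i ∈ C, ((m i).1 i + 1)) i
    have hx : ∑ i, x i = N := by
      simp only [x, Finset.sum_add_distrib, Finset.sum_ite_mem, Finset.univ_inter,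
        Finset.sum_pi_single', Finset.mem_univ, if_true]
      rw [Finset.sum_add_distrib] at hle
      omega
    obtain ⟨i, hi, hix⟩ := hdom ⟨x, by simp [Finset.mem_piAntidiag, hx]⟩
    have := hix _ (hmσ i)
    have hiC : i ∈ C := by simpa [C] using hi
    simp only [x, if_pos hiC] at this
    omega
  have hCcard : C.card ≤ Fintype.card ι := C.card_le_univ
  have hC : ∀ s : X, Sum.inl s ∈ σ → ∀ i,
      (i ∈ C → s.1 i ≤ (m i).1 i + Fintype.card ι) ∧ (i ∉ C → s.1 i ≤ Fintype.card ι) := by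
    intro s hs i
    rw [Finset.sum_add_distrib, Finset.sum_const, smul_eq_mul, mul_one] at hsum
    have htot : ∑ j ∈ C, s.1 j + ∑ j ∈ Cᶜ, s.1 j = N := by
      rw [Finset.sum_add_sum_compl, hXsum]
    constructor
    · intro hi
      have h1 : ∑ j ∈ C.erase i, (m j).1 j ≤ ∑ j ∈ C.erase i, s.1 j :=
        Finset.sum_le_sum fun j _ => hm j s hs
      have h2 := Finset.add_sum_erase C (fun j => s.1 j) hi
      have h3 := Finset.add_sum_erase C (fun j => (m j).1 j) hi
      omega
    · intro hi
      have h1 : ∑ j ∈ C, (m j).1 j ≤ ∑ j ∈ C, s.1 j := Finset.sum_le_sum fun j _ => hm j s hs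
      have h2 : s.1 i ≤ ∑ j ∈ Cᶜ, s.1 j :=
        Finset.single_le_sum (f := fun j => s.1 j) (fun _ _ => Nat.zero_le _) (by simpa using hi)
      omega
  refine ⟨s₀.1, hXsum s₀, fun i => ?_⟩
  by_cases hi : i ∈ C
  · obtain ⟨s, hs, hsi⟩ := hcol i (by simpa [C] using hi)
    refine Or.inr ⟨s.1, hXsum s, fun j => ?_, hsi⟩
    rw [abs_le]
    have h1 := hC s hs j
    have h2 := hC s₀ hs₀ j
    by_cases hj : j ∈ C
    · have h1 := h1.1 hj
      have h2 := h2.1 hj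
      have h3 := hm j s hs
      have h4 := hm j s₀ hs₀
      omega
    · have h1 := h1.2 hj
      have h2 := h2.2 hj
      omega
  · exact Or.inl ((hC s₀ hs₀ i).2 hi)

/-- **Brouwer's fixed point theorem** on the standard simplex. -/
theorem exists_fixedPoint_stdSimplex [Nonempty ι] {f : (ι → ℝ) → ι → ℝ}
    (hf : ContinuousOn f (stdSimplex ℝ ι))
    (hmaps : Set.MapsTo f (stdSimplex ℝ ι) (stdSimplex ℝ ι)) :
    ∃ x ∈ stdSimplex ℝ ι, f x = x := by
  classical
  rcases subsingleton_or_nontrivial ι with hsub | hnt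
  · obtain ⟨k⟩ : Nonempty ι := inferInstance
    have hsingle := single_mem_stdSimplex ℝ k
    refine ⟨_, hsingle, ?_⟩
    have h1 := (hmaps hsingle).2
    have h2 := hsingle.2
    ext i
    rw [Fintype.sum_subsingleton _ i] at h1 h2
    rw [h1, h2]
  have hcol : ∀ x ∈ stdSimplex ℝ ι, ∃ i, x i ≤ f x i := by
    intro x hx
    by_contra! h
    have h1 := Finset.sum_lt_sum_of_nonempty Finset.univ_nonempty fun i _ => h i
    rw [(hmaps hx).2, hx.2] at h1
    exact lt_irrefl _ h1
  have happrox : ∀ N : ℕ, ∃ x ∈ stdSimplex ℝ ι, ∀ i, ∃ y ∈ stdSimplex ℝ ι,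
      (∀ j, |y j - x j| ≤ Fintype.card ι / ((N : ℝ) + 1)) ∧
      (x i ≤ Fintype.card ι / ((N : ℝ) + 1) ∨ y i ≤ f y i) := by
    intro N
    have hN : (0 : ℝ) < (N : ℝ) + 1 := by positivity
    let q : (ι → ℕ) → ι → ℝ := fun s i => s i / ((N : ℝ) + 1)
    have hq : ∀ s : ι → ℕ, ∑ i, s i = N + 1 → q s ∈ stdSimplex ℝ ι := by
      intro s hs
      refine ⟨fun i => by positivity, ?_⟩
      simp only [q]
      rw [← Finset.sum_div, ← Nat.cast_sum, hs]
      push_cast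
      exact div_self hN.ne'
    have hc : ∀ s : ι → ℕ, ∃ i, ∑ i, s i = N + 1 → q s i ≤ f (q s) i := by
      intro s
      by_cases hs : ∑ i, s i = N + 1
      · obtain ⟨i, hi⟩ := hcol _ (hq s hs)
        exact ⟨i, fun _ => hi⟩
      · exact ⟨Classical.arbitrary ι, fun h => absurd h hs⟩
    choose c hc using hc
    obtain ⟨s, hs, hs'⟩ := exists_grid_point_near_colours (N + 1) c
    refine ⟨q s, hq s hs, fun i => ?_⟩
    rcases hs' i with hi | ⟨s', hsum, hnear, hcs⟩
    · refine ⟨q s, hq s hs, fun j => by rw [sub_self, abs_zero]; positivity, Or.inl ?_⟩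
      simp only [q]
      gcongr
    · refine ⟨q s', hq s' hsum, fun j => ?_, Or.inr (hcs ▸ hc s' hsum)⟩
      simp only [q]
      rw [← sub_div, abs_div, abs_of_pos hN]
      gcongr
      exact_mod_cast hnear j
  choose x hx y hy hxy hor using happrox
  obtain ⟨a, ha, k, hk, hlim⟩ := (isCompact_stdSimplex ℝ ι).tendsto_subseq hx
  have hzero : Tendsto (fun n => (Fintype.card ι : ℝ) / ((k n : ℝ) + 1)) atTop (𝓝 0) :=
    (tendsto_const_nhds.div_atTop
      (tendsto_atTop_add_const_right _ _ tendsto_natCast_atTop_atTop)).comp hk.tendsto_atTop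
  have hle : ∀ i, a i ≤ f a i := by
    intro i
    have hyi : Tendsto (fun n => y (k n) i) atTop (𝓝 a) := by
      rw [tendsto_pi_nhds] at hlim ⊢
      intro j
      have h : Tendsto (fun n => y (k n) i j - x (k n) j) atTop (𝓝 0) :=
        squeeze_zero_norm (fun n => hxy (k n) i j) hzero
      simpa using h.add (hlim j)
    have hfy := ((hf a ha).tendsto.comp (tendsto_nhdsWithin_iff.2
      ⟨hyi, Eventually.of_forall fun n => hy (k n) i⟩))
    by_contra! hlt
    have h1 : ∀ᶠ n in atTop, f (y (k n) i) i < y (k n) i i :=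
      (tendsto_pi_nhds.1 hfy i).eventually_lt (tendsto_pi_nhds.1 hyi i) hlt
    have h2 : ∀ᶠ n in atTop, (Fintype.card ι : ℝ) / ((k n : ℝ) + 1) < x (k n) i :=
      hzero.eventually_lt (tendsto_pi_nhds.1 hlim i) (((hmaps ha).1 i).trans_lt hlt)
    obtain ⟨n, h1, h2⟩ := (h1.and h2).exists
    rcases hor (k n) i with h | h <;> linarith
  refine ⟨a, ha, ?_⟩
  have hsum : ∑ i, a i = ∑ i, f a i := by rw [ha.2, (hmaps ha).2]
  ext i
  exact ((Finset.sum_eq_sum_iff_of_le fun i _ => hle i).1 hsum i (Finset.mem_univ i)).symm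

end Brouwer

/-! ### Ky Fan's inequality -/

/-- **Ky Fan's inequality**, for bifunctions that are convex in the second variable. -/
theorem exists_forall_nonneg_of_convexOn {E : Type*} [NormedAddCommGroup E] [NormedSpace ℝ E]
    {K : Set E} (hK : IsCompact K) (hKc : Convex ℝ K) (hne : K.Nonempty) {f : E → E → ℝ}
    (husc : ∀ w ∈ K, UpperSemicontinuousOn (fun a => f a w) K)
    (hconv : ∀ a ∈ K, ConvexOn ℝ K (f a)) (hdiag : ∀ a ∈ K, 0 ≤ f a a) :
    ∃ a ∈ K, ∀ w ∈ K, 0 ≤ f a w := by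
  classical
  by_contra! hno
  have hopen : ∀ w : K, ∃ U : Set E, IsOpen U ∧ ∀ a ∈ K, a ∈ U ↔ f a w < 0 := by
    intro w
    obtain ⟨U, hU, hUe⟩ := upperSemicontinuousOn_iff_preimage_Iio.1 (husc w w.2) 0
    exact ⟨U, hU, fun a ha => by
      have := Set.ext_iff.1 hUe a
      simpa [ha] using this.symm⟩
  choose U hU hUf using hopen
  obtain ⟨t, ht⟩ := hK.elim_finite_subcover U hU fun a ha => by
    obtain ⟨w, hw, hlt⟩ := hno a ha
    exact Set.mem_iUnion.2 ⟨⟨w, hw⟩, (hUf ⟨w, hw⟩ a ha).2 hlt⟩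
  obtain ⟨β, hβ⟩ := PartitionOfUnity.exists_isSubordinate hK.isClosed (fun w : t => U w)
    (fun w => hU w) (fun a ha => by
      obtain ⟨w, hwt, haw⟩ := Set.mem_iUnion₂.1 (ht ha)
      exact Set.mem_iUnion.2 ⟨⟨w, hwt⟩, haw⟩)
  have hβsum : ∀ a ∈ K, ∑ w, β w a = 1 := fun a ha => by
    rw [← finsum_eq_sum_of_fintype]; exact β.sum_eq_one ha
  have htne : Nonempty t := by
    obtain ⟨a, ha⟩ := hne
    obtain ⟨w, hwt, -⟩ := Set.mem_iUnion₂.1 (ht ha)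
    exact ⟨⟨w, hwt⟩⟩
  let P : (t → ℝ) → E := fun l => ∑ w, l w • (w : E)
  have hP : ∀ l ∈ stdSimplex ℝ t, P l ∈ K := fun l hl =>
    hKc.sum_mem (fun w _ => hl.1 w) hl.2 fun w _ => w.1.2
  have hPc : Continuous P := by fun_prop
  obtain ⟨l, hl, hfix⟩ := exists_fixedPoint_stdSimplex (f := fun l w => β w (P l))
    (continuous_pi fun w => (β w).continuous.comp hPc).continuousOn
    (fun l hl => ⟨fun w => β.nonneg w _, hβsum _ (hP l hl)⟩)
  have hPl := hP l hl
  have hfix' : ∀ w, β w (P l) = l w := fun w => congrFun hfix w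
  have hle : f (P l) (P l) ≤ ∑ w : t, l w • f (P l) w :=
    (hconv _ hPl).map_sum_le (fun w _ => hl.1 w) hl.2 fun w _ => w.1.2
  have hterm : ∀ w : t, l w ≠ 0 → f (P l) w < 0 := fun w hw =>
    (hUf w _ hPl).1 (hβ w (subset_tsupport _ (by
      rw [Function.mem_support, hfix' w]; exact hw)))
  have hlt : ∑ w : t, l w • f (P l) w < ∑ w : t, (0 : ℝ) := by
    refine Finset.sum_lt_sum (fun w _ => ?_) ?_
    · by_cases hw : l w = 0
      · simp [hw]
      · exact mul_nonpos_of_nonneg_of_nonpos (hl.1 w) (hterm w hw).le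
    · obtain ⟨w, -, hw⟩ : ∃ w ∈ Finset.univ, l w ≠ 0 := by
        apply Finset.exists_ne_zero_of_sum_ne_zero
        rw [hl.2]; exact one_ne_zero
      exact ⟨w, Finset.mem_univ w,
        mul_neg_of_pos_of_neg (lt_of_le_of_ne (hl.1 w) hw.symm) (hterm w hw)⟩
  rw [Finset.sum_const_zero] at hlt
  linarith [hdiag _ hPl]

/-! ### Weak convergence in reflexive spaces -/

section Weak

variable {V : Type v} [NormedAddCommGroup V] [NormedSpace ℝ V]

lemma weakTendsto_iff {ι : Type*} {x : ι → V} {l : Filter ι} {a : V} :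
    WeakTendsto x l a ↔ ∀ f : StrongDual ℝ V, Tendsto (fun i => f (x i)) l (𝓝 (f a)) := by
  refine WeakBilin.tendsto_iff_forall_eval_tendsto (topDualPairing ℝ V).flip ?_
  intro y z h
  by_contra hne
  obtain ⟨f, -, hf⟩ := exists_dual_vector ℝ (y - z) (norm_ne_zero_iff.2 (sub_ne_zero.2 hne))
  have h1 : f y = f z := LinearMap.congr_fun h f
  rw [map_sub, h1, sub_self] at hf
  exact norm_ne_zero_iff.2 (sub_ne_zero.2 hne) (by simpa using hf.symm)

lemma WeakTendsto.of_tendsto {ι : Type*} {x : ι → V} {l : Filter ι} {a : V}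
    (h : Tendsto x l (𝓝 a)) : WeakTendsto x l a :=
  weakTendsto_iff.2 fun f => (f.continuous.tendsto a).comp h

/-- Closed convex sets are weakly closed. -/
lemma WeakTendsto.mem_of_isClosed {ι : Type*} {x : ι → V} {l : Filter ι} [l.NeBot] {a : V}
    (h : WeakTendsto x l a) {C : Set V} (hC : IsClosed C) (hconv : Convex ℝ C)
    (hx : ∀ i, x i ∈ C) : a ∈ C := by
  by_contra ha
  obtain ⟨f, b, hfb, hb⟩ := geometric_hahn_banach_closed_point hconv hC ha
  exact not_le.2 hb (le_of_tendsto (weakTendsto_iff.1 h f)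
    (Eventually.of_forall fun i => (hfb _ (hx i)).le))

/-- By the Banach-Alaoglu theorem in the bidual, a bounded family in a reflexive space converges
weakly along every ultrafilter. -/
lemma IsReflexiveSpace.exists_weakTendsto_ultrafilter (hV : IsReflexiveSpace V) {ι : Type*}
    (U : Ultrafilter ι) {x : ι → V} {R : ℝ} (hx : ∀ᶠ i in U, ‖x i‖ ≤ R) :
    ∃ a, WeakTendsto x U a := by
  let J : ι → WeakDual ℝ (StrongDual ℝ V) := fun i =>
    StrongDual.toWeakDual (NormedSpace.inclusionInDoubleDual ℝ V (x i))
  have hJ : (U.map J : Filter _) ≤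
      𝓟 (WeakDual.toStrongDual ⁻¹' Metric.closedBall (0 : StrongDual ℝ (StrongDual ℝ V)) R) := by
    rw [le_principal_iff]
    change ∀ᶠ i in (U : Filter ι), J i ∈ _
    filter_upwards [hx] with i hi
    have h : ‖NormedSpace.inclusionInDoubleDual ℝ V (x i)‖ ≤ R :=
      (NormedSpace.double_dual_bound ℝ V (x i)).trans hi
    exact (dist_zero_right (NormedSpace.inclusionInDoubleDual ℝ V (x i))).trans_le h
  obtain ⟨ξ, -, hξ⟩ := (WeakDual.isCompact_closedBall _ R).ultrafilter_le_nhds (U.map J) hJ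
  obtain ⟨a, ha⟩ := hV (WeakDual.toStrongDual ξ)
  refine ⟨a, weakTendsto_iff.2 fun f => ?_⟩
  have h := ((WeakDual.eval_continuous f).tendsto ξ).comp (show Tendsto J U (𝓝 ξ) from hξ)
  have hfa : f a = ξ f := by
    rw [← NormedSpace.dual_def ℝ V a f, ha]; rfl
  rw [hfa]
  exact h

/-- Countably many functionals separate the points of the closed span of a sequence, so a
subsequence along which all of them converge has a single weak cluster point. -/
lemma IsReflexiveSpace.exists_subseq_weakTendsto (hV : IsReflexiveSpace V) {x : ℕ → V} {R : ℝ}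
    (hx : ∀ n, ‖x n‖ ≤ R) : ∃ (a : V) (k : ℕ → ℕ), StrictMono k ∧ WeakTendsto (x ∘ k) atTop a := by
  let W : Submodule ℝ V := (Submodule.span ℝ (Set.range x)).topologicalClosure
  have hW : TopologicalSpace.IsSeparable (W : Set V) :=
    ((Set.countable_range x).isSeparable.span (R := ℝ)).closure
  obtain ⟨s, hs, hWs⟩ := hW
  have : Countable s := hs
  have hf : ∀ w : s, ∃ f : StrongDual ℝ V, ‖f‖ ≤ 1 ∧ f w = ‖(w : V)‖ := fun w =>
    exists_dual_vector'' ℝ (w : V)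
  choose f hf1 hfw using hf
  have hfle : ∀ w y, |f w y| ≤ ‖y‖ := fun w y =>
    ((f w).le_opNorm y).trans (mul_le_of_le_one_left (norm_nonneg _) (hf1 w))
  have hsep : ∀ y ∈ W, (∀ w, f w y = 0) → y = 0 := by
    intro y hy h0
    by_contra hne
    have hpos : 0 < ‖y‖ := norm_pos_iff.2 hne
    obtain ⟨w, hw, hd⟩ := Metric.mem_closure_iff.1 (hWs hy) (‖y‖ / 2) (half_pos hpos)
    rw [dist_eq_norm] at hd
    have h1 := hfle ⟨w, hw⟩ (y - w)
    rw [map_sub, h0, hfw, zero_sub, abs_neg, abs_norm] at h1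
    have h2 := norm_add_le (y - w) w
    rw [sub_add_cancel] at h2
    simp only at h1
    linarith
  obtain ⟨b, -, k, hk, hb⟩ := (isCompact_univ_pi fun _ : s =>
    (isCompact_Icc : IsCompact (Set.Icc (-R) R))).tendsto_subseq
    (x := fun n w => f w (x n)) fun n w _ => abs_le.1 ((hfle w (x n)).trans (hx n))
  have hmem : ∀ n, (x ∘ k) n ∈ W := fun n =>
    Submodule.le_topologicalClosure _ (Submodule.subset_span ⟨k n, rfl⟩)
  have hlim : ∀ U : Ultrafilter ℕ, (U : Filter ℕ) ≤ atTop →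
      ∃ a ∈ W, (∀ w, f w a = b w) ∧ WeakTendsto (x ∘ k) U a := by
    intro U hU
    obtain ⟨a, ha⟩ := hV.exists_weakTendsto_ultrafilter U (x := x ∘ k) (R := R)
      (Eventually.of_forall fun n => hx (k n))
    refine ⟨a, ha.mem_of_isClosed (Submodule.isClosed_topologicalClosure _) W.convex hmem,
      fun w => ?_, ha⟩
    exact tendsto_nhds_unique (weakTendsto_iff.1 ha (f w)) ((tendsto_pi_nhds.1 hb w).mono_left hU)
  obtain ⟨a, haW, hab, -⟩ := hlim (Ultrafilter.of atTop) (Ultrafilter.of_le atTop)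
  refine ⟨a, k, hk, weakTendsto_iff.2 fun g => ?_⟩
  rw [tendsto_iff_ultrafilter]
  intro U hU
  obtain ⟨a', haW', hab', h'⟩ := hlim U hU
  have : a - a' = 0 := hsep _ (W.sub_mem haW haW') fun w => by
    rw [map_sub, hab, hab', sub_self]
  rw [sub_eq_zero.1 this]
  exact weakTendsto_iff.1 h' g

/-! ### Norm compactness from the seminorm -/

lemma SeminormCompactness.exists_subseq_tendsto (hV : IsReflexiveSpace V) {p : Seminorm ℝ V}
    (hp : SeminormCompactness p) {x : ℕ → V} {R : ℝ} (hx : ∀ n, ‖x n‖ ≤ R)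
    (hpx : Tendsto (fun n => p (x n)) atTop (𝓝 0)) :
    ∃ (a : V) (k : ℕ → ℕ), StrictMono k ∧ Tendsto (x ∘ k) atTop (𝓝 a) := by
  obtain ⟨a, k, hk, ha⟩ := hV.exists_subseq_weakTendsto hx
  by_cases h : ∃ η : ℝ, 0 < η ∧ ∀ᶠ n in atTop, η ≤ ‖x (k n)‖
  · obtain ⟨η, hη, hev⟩ := h
    obtain ⟨N, hN⟩ := eventually_atTop.1 hev
    have hadd : Tendsto (fun n => n + N) atTop atTop := tendsto_add_atTop_nat N
    obtain ⟨l, hl, hlim⟩ := hp (fun n => x (k (n + N))) a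
      (hpx.comp (hk.tendsto_atTop.comp hadd))
      (weakTendsto_iff.2 fun f => (weakTendsto_iff.1 ha f).comp hadd)
      ⟨η, hη, fun n => hN _ (Nat.le_add_left _ _)⟩
    exact ⟨a, fun n => k (l n + N), fun m n hmn => hk (Nat.add_lt_add_right (hl hmn) N), hlim⟩
  · -- otherwise a subsequence tends to zero in norm
    push Not at h
    obtain ⟨l, hl, hlt⟩ := extraction_forall_of_frequently
      (P := fun m n => ‖x (k n)‖ < 1 / ((m : ℝ) + 1)) fun m => h _ (by positivity)
    refine ⟨0, fun n => k (l n), hk.comp hl, ?_⟩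
    exact squeeze_zero_norm (fun n => (hlt n).le) tendsto_one_div_add_atTop_nhds_zero_nat

/-- The compactness condition, stated for sequences, yields norm convergence along ultrafilters:
the sets `{‖y‖ ≤ R, p y ≤ 1 / (n + 1)}` have arbitrarily fine finite covers for large `n`. -/
lemma SeminormCompactness.exists_tendsto_ultrafilter [CompleteSpace V] (hV : IsReflexiveSpace V)
    {p : Seminorm ℝ V} (hp : SeminormCompactness p) {ι : Type*} (U : Ultrafilter ι) {x : ι → V}
    {R : ℝ} (hx : ∀ᶠ i in U, ‖x i‖ ≤ R) (hpx : Tendsto (fun i => p (x i)) U (𝓝 0)) :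
    ∃ a, Tendsto x U (𝓝 a) := by
  have hcover : ∀ ε > 0, ∃ (n : ℕ) (t : Set V), t.Finite ∧
      ∀ y, ‖y‖ ≤ R → p y ≤ 1 / ((n : ℝ) + 1) → ∃ z ∈ t, dist y z < ε := by
    intro ε hε
    by_contra! hno
    -- an `ε`-separated sequence along which `p` tends to zero
    obtain ⟨F, hF, hsep⟩ := exists_seq_of_forall_finset_exists (α := ℕ × V)
      (fun q => ‖q.2‖ ≤ R ∧ p q.2 ≤ 1 / ((q.1 : ℝ) + 1))
      (fun q q' => q.1 < q'.1 ∧ ε ≤ dist q'.2 q.2) (by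
        classical
        intro s _
        obtain ⟨y, hyR, hyp, hy⟩ := hno (s.sup Prod.fst + 1) (s.image Prod.snd)
          (Finset.finite_toSet _)
        refine ⟨(_, y), ⟨hyR, hyp⟩, fun q hq => ⟨?_, ?_⟩⟩
        · exact Nat.lt_succ_of_le (Finset.le_sup (f := Prod.fst) hq)
        · exact hy _ (Finset.mem_coe.2 (Finset.mem_image_of_mem _ hq)))
    have hmono : StrictMono fun n => (F n).1 := fun m n hmn => (hsep m n hmn).1
    obtain ⟨a, k, hk, ha⟩ := hp.exists_subseq_tendsto hV (x := fun n => (F n).2)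
      (fun n => (hF n).1)
      (squeeze_zero (fun n => apply_nonneg p _) (fun n => (hF n).2)
        (tendsto_one_div_add_atTop_nhds_zero_nat.comp hmono.tendsto_atTop))
    obtain ⟨N, hN⟩ := Metric.cauchySeq_iff.1 ha.cauchySeq ε hε
    exact absurd (hN (N + 1) (Nat.le_succ N) N le_rfl)
      (not_lt.2 (hsep _ _ (hk (Nat.lt_succ_self N))).2)
  have hcauchy : Cauchy (map x U) := by
    rw [Metric.cauchy_iff]
    refine ⟨inferInstance, fun ε hε => ?_⟩
    obtain ⟨n, t, ht, hcov⟩ := hcover (ε / 2) (half_pos hε)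
    have hmem : (⋃ z ∈ t, {i | dist (x i) z < ε / 2}) ∈ U := by
      have hn : (0 : ℝ) < 1 / ((n : ℝ) + 1) := by positivity
      filter_upwards [hx, hpx.eventually_lt_const hn] with i hi hpi
      obtain ⟨z, hz, hd⟩ := hcov _ hi hpi.le
      exact Set.mem_iUnion₂.2 ⟨z, hz, hd⟩
    obtain ⟨z, -, hzU⟩ := (Ultrafilter.finite_biUnion_mem_iff ht).1 hmem
    refine ⟨Metric.ball z (ε / 2), hzU, fun y hy w hw => ?_⟩
    have h1 := Metric.mem_ball.1 hy
    have h2 := Metric.mem_ball'.1 hw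
    linarith [dist_triangle y z w]
  exact CompleteSpace.complete hcauchy

/-! ### Positive linear operators -/

/-- A positive linear operator from a Banach space to its dual is bounded, by the closed graph
theorem. -/
lemma LinearMap.continuous_of_forall_apply_self_nonneg [CompleteSpace V]
    (A : V →ₗ[ℝ] StrongDual ℝ V) (hA : ∀ w, 0 ≤ A w w) : Continuous A := by
  refine A.continuous_of_seq_closed_graph fun x a y hx hy => ?_
  have hpos : ∀ w, 0 ≤ (y - A w) (a - w) := by
    intro w
    have h1 := (isBoundedBilinearMap_apply.continuous.tendsto (y - A w, a - w)).comp
      ((hy.sub tendsto_const_nhds).prodMk_nhds (hx.sub tendsto_const_nhds))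
    refine ge_of_tendsto' h1 fun n => ?_
    have h2 := hA (x n - w)
    rw [A.map_sub] at h2
    exact h2
  ext z
  have hquad : ∀ t : ℝ, 0 ≤ A z z * (t * t) + (y z - A a z) * t + 0 := by
    intro t
    have h := hpos (a - t • z)
    have e : (y - A (a - t • z)) (a - (a - t • z)) =
        A z z * (t * t) + (y z - A a z) * t + 0 := by
      rw [sub_sub_cancel, map_sub, map_smul]
      simp
      ring
    rwa [e] at h
  have hd := discrim_le_zero hquad
  rw [discrim, mul_zero, sub_zero] at hd
  exact sub_eq_zero.1 (pow_eq_zero_iff two_ne_zero |>.1 (le_antisymm hd (sq_nonneg _)))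

end Weak

/-! ### Nets and filters -/

/-- Every proper filter is the image of `atTop` under a net: index by the pairs of a member `S` of
the filter and a point of `S`, ordered by reverse inclusion of the sets. -/
lemma exists_net_map_atTop_eq {J : Type u} (F : Filter J) [F.NeBot] :
    ∃ (T' : Type u) (_ : Preorder T') (_ : IsDirectedOrder T') (_ : Nonempty T') (k : T' → J),
      map k atTop = F := by
  let T' := {q : Set J × J // q.1 ∈ F ∧ q.2 ∈ q.1}
  have hmk : ∀ S ∈ F, ∃ q : T', q.1.1 = S := fun S hS => by
    obtain ⟨j, hj⟩ := F.nonempty_of_mem hS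
    exact ⟨⟨(S, j), hS, hj⟩, rfl⟩
  let _ : Preorder T' := Preorder.lift fun q => OrderDual.toDual q.1.1
  have hle : ∀ q q' : T', q ≤ q' ↔ q'.1.1 ⊆ q.1.1 := fun _ _ => Iff.rfl
  have hdir : IsDirectedOrder T' := ⟨fun q q' => by
    obtain ⟨q'', h⟩ := hmk _ (inter_mem q.2.1 q'.2.1)
    exact ⟨q'', (hle _ _).2 (h ▸ Set.inter_subset_left), (hle _ _).2 (h ▸ Set.inter_subset_right)⟩⟩
  have hne : Nonempty T' := ⟨(hmk _ univ_mem).choose⟩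
  refine ⟨T', inferInstance, hdir, hne, fun q => q.1.2, ?_⟩
  ext S
  rw [mem_map, mem_atTop_sets]
  constructor
  · rintro ⟨q, hq⟩
    exact mem_of_superset q.2.1 fun j hj => hq ⟨(q.1.1, j), q.2.1, hj⟩ ((hle _ _).2 subset_rfl)
  · intro hS
    obtain ⟨q, rfl⟩ := hmk S hS
    exact ⟨q, fun q' hq' => (hle _ _).1 hq' q'.2.2⟩

section FilterForms

variable {V : Type v} [NormedAddCommGroup V] [NormedSpace ℝ V] {T : Type u} [Preorder T]
  {Kt : T → Set V} {K : Set V}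

lemma WeakTendsto.congr' {ι : Type*} {x y : ι → V} {l : Filter ι} {a : V}
    (h : WeakTendsto x l a) (hxy : x =ᶠ[l] y) : WeakTendsto y l a :=
  weakTendsto_iff.2 fun f => (weakTendsto_iff.1 h f).congr' (hxy.mono fun i hi => by rw [hi])

lemma WeakTendsto.comp {ι κ : Type*} {x : ι → V} {l : Filter ι} {a : V} {l' : Filter κ}
    {k : κ → ι} (h : WeakTendsto x l a) (hk : Tendsto k l' l) :
    WeakTendsto (fun s => x (k s)) l' a :=
  weakTendsto_iff.2 fun f => (weakTendsto_iff.1 h f).comp hk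

/-- The condition on nets, for limits along an arbitrary filter. -/
lemma MoscoLimsup.mem_of_weakTendsto (hK : MoscoLimsup Kt K) (h0 : ∀ t, (0 : V) ∈ Kt t)
    {J : Type u} {F : Filter J} [F.NeBot] {h : J → T} (hh : Tendsto h F atTop) {x : J → V} {a : V}
    (hx : ∀ᶠ j in F, x j ∈ Kt (h j)) (hxa : WeakTendsto x F a) : a ∈ K := by
  classical
  obtain ⟨T', _, _, _, k, hk⟩ := exists_net_map_atTop_eq F
  let x' : J → V := fun j => if x j ∈ Kt (h j) then x j else 0
  have hx' : x =ᶠ[F] x' := hx.mono fun j hj => (if_pos hj).symm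
  have hx'mem : ∀ j, x' j ∈ Kt (h j) := fun j => by
    by_cases hj : x j ∈ Kt (h j)
    · simpa only [x', if_pos hj] using hj
    · simpa only [x', if_neg hj] using h0 _
  exact hK T' (fun s => h (k s)) (hh.comp hk.le) (fun s => x' (k s)) a (fun s => hx'mem (k s))
    ((hxa.congr' hx').comp hk.le)

/-- The condition on nets, for limits along an arbitrary filter. -/
lemma BifunctionLimsup.eventually_lt {φt : T → V → V → ℝ} {φ : V → V → ℝ}
    (hφ : BifunctionLimsup Kt φt φ) (h0 : ∀ t, (0 : V) ∈ Kt t)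
    {J : Type u} {F : Filter J} [F.NeBot] {h : J → T} (hh : Tendsto h F atTop) {x y : J → V}
    {a b : V} (hx : ∀ᶠ j in F, x j ∈ Kt (h j)) (hy : ∀ j, y j ∈ Kt (h j))
    (hxa : WeakTendsto x F a) (hyb : Tendsto y F (𝓝 b)) {r : ℝ} (hr : φ a b < r) :
    ∀ᶠ j in F, φt (h j) (x j) (y j) < r := by
  classical
  obtain ⟨T', _, _, _, k, hk⟩ := exists_net_map_atTop_eq F
  let x' : J → V := fun j => if x j ∈ Kt (h j) then x j else 0
  have hx' : x =ᶠ[F] x' := hx.mono fun j hj => (if_pos hj).symm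
  have hx'mem : ∀ j, x' j ∈ Kt (h j) := fun j => by
    by_cases hj : x j ∈ Kt (h j)
    · simpa only [x', if_pos hj] using hj
    · simpa only [x', if_neg hj] using h0 _
  have hlim := hφ T' (fun s => h (k s)) (hh.comp hk.le) (fun s => x' (k s)) (fun s => y (k s)) a b
    (fun s => hx'mem (k s)) (fun s => hy (k s)) ((hxa.congr' hx').comp hk.le) (hyb.comp hk.le)
  have hev := eventually_lt_of_limsup_lt (hlim.trans_lt (EReal.coe_lt_coe_iff.2 hr))
  have hev' : ∀ᶠ j in F, φt (h j) (x' j) (y j) < r := by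
    rw [← hk, eventually_map]
    exact hev.mono fun s hs => EReal.coe_lt_coe_iff.1 hs
  filter_upwards [hev', hx'] with j hj hxj
  rwa [hxj]

end FilterForms

/-! ### Approximation of the variational inequality -/

section VI

variable {V : Type v} [NormedAddCommGroup V] [NormedSpace ℝ V]

lemma IsVISolution.apply_self_le {A : V →ₗ[ℝ] StrongDual ℝ V} {φ : V → V → ℝ}
    {g : StrongDual ℝ V} {K : Set V} {c : ℝ} (h0 : (0 : V) ∈ K) (hφ : ∀ a ∈ K, φ a 0 ≤ c * ‖a‖)
    {a : V} (ha : IsVISolution A φ g K a) : A a a ≤ g a + c * ‖a‖ := by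
  have h1 := ha.2 0 h0
  have h2 := hφ a ha.1
  simp only [zero_sub, map_neg] at h1
  linarith

/-- The variational inequality is solvable on a closed convex set of finite dimension as soon as
some `R` bounds all `a ∈ K` with `⟨A a, a⟩ ≤ ⟨g, a⟩ + c ‖a‖`: a solution on the intersection of `K`
with a ball of larger radius is interior to that ball, hence a solution on `K`. -/
theorem exists_isVISolution_of_finiteDimensional {A : V →ₗ[ℝ] StrongDual ℝ V} (hA : Continuous A)
    {φ : V → V → ℝ} {g : StrongDual ℝ V} {K : Set V} {c R : ℝ} (F : Submodule ℝ V)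
    [FiniteDimensional ℝ F] (hKF : K ⊆ F) (hK : IsClosed K) (hKc : Convex ℝ K) (h0 : (0 : V) ∈ K)
    (husc : ∀ w ∈ K, UpperSemicontinuousOn (fun a => φ a w) K)
    (hgrowth : ∀ a ∈ K, φ a 0 ≤ c * ‖a‖) (hconv : ∀ a ∈ K, ConvexOn ℝ K (φ a))
    (hdiag : ∀ a ∈ K, φ a a = 0) (hR : ∀ a ∈ K, A a a ≤ g a + c * ‖a‖ → ‖a‖ ≤ R) :
    ∃ a, IsVISolution A φ g K a := by
  have hR0 : 0 ≤ R := by simpa using hR 0 h0 (by simp)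
  let B : Set V := K ∩ Metric.closedBall 0 (R + 1)
  have hBK : B ⊆ K := Set.inter_subset_left
  have hBconv : Convex ℝ B := hKc.inter (convex_closedBall _ _)
  have h0B : (0 : V) ∈ B := ⟨h0, Metric.mem_closedBall_self (by linarith)⟩
  have hBc : IsCompact B := by
    have : ProperSpace F := FiniteDimensional.proper ℝ F
    have h1 : IsCompact ((↑) ⁻¹' B : Set F) := by
      refine Metric.isCompact_of_isClosed_isBounded
        ((hK.inter Metric.isClosed_closedBall).preimage continuous_subtype_val)
        (Metric.isBounded_closedBall (x := (0 : F)) (r := R + 1) |>.subset fun y hy => ?_)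
      simpa using hy.2
    convert h1.image continuous_subtype_val
    exact (Set.image_preimage_eq_of_subset
      ((hBK.trans hKF).trans Subtype.range_coe.symm.subset)).symm
  let f : V → V → ℝ := fun a w => (A a (w - a) - g (w - a)) + φ a w
  have hfdiag : ∀ a ∈ K, f a a = 0 := fun a ha => by simp [f, hdiag a ha]
  have hfconv : ∀ a ∈ K, ConvexOn ℝ K (f a) := by
    intro a ha
    refine ConvexOn.add ⟨hKc, fun x _ y _ s t _ _ hst => le_of_eq ?_⟩ (hconv a ha)
    have hs : s = 1 - t := by linarith
    subst hs
    simp only [map_sub, map_add, map_smul, smul_eq_mul]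
    ring
  obtain ⟨a, haB, ha⟩ := exists_forall_nonneg_of_convexOn hBc hBconv ⟨0, h0B⟩ (f := f)
    (fun w hw => by
      refine UpperSemicontinuousOn.add
        ((Continuous.upperSemicontinuous ?_).upperSemicontinuousOn _) ((husc w (hBK hw)).mono hBK)
      fun_prop)
    (fun a ha => (hfconv a (hBK ha)).subset hBK hBconv) (fun a ha => (hfdiag a (hBK ha)).ge)
  have haK := hBK haB
  have haR : ‖a‖ ≤ R := by
    refine hR a haK ?_
    have h1 := ha 0 h0B
    have h2 := hgrowth a haK
    simp only [f, zero_sub, map_neg] at h1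
    linarith
  refine ⟨a, haK, fun w hw => ?_⟩
  -- a point of the segment from `a` to `w` that still lies in the ball
  let s : ℝ := 1 / (1 + ‖w - a‖)
  have hs0 : 0 < s := by positivity
  have hs1 : s ≤ 1 := by
    rw [div_le_one (by positivity)]
    linarith [norm_nonneg (w - a)]
  have hz : (1 - s) • a + s • w ∈ B := by
    refine ⟨hKc haK hw (by linarith) hs0.le (by ring), mem_closedBall_zero_iff.2 ?_⟩
    have e : (1 - s) • a + s • w = a + s • (w - a) := by module
    have h1 : ‖s • (w - a)‖ ≤ 1 := by
      rw [norm_smul, Real.norm_of_nonneg hs0.le, one_div_mul_eq_div, div_le_one (by positivity)]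
      linarith
    rw [e]
    linarith [norm_add_le a (s • (w - a))]
  have h1 := ha _ hz
  have h2 := (hfconv a haK).2 haK hw (by linarith : 0 ≤ 1 - s) hs0.le (by ring)
  rw [hfdiag a haK, smul_zero, zero_add, smul_eq_mul] at h2
  have h3 : 0 ≤ f a w := nonneg_of_mul_nonneg_right (h1.trans h2) hs0
  simp only [f] at h3
  linarith

variable {T : Type u} [Preorder T]

/-- A weak limit of a bounded family of approximate solutions solves the limit problem. Taking the
limit as test vector shows moreover that `⟨A (xₜ - a), xₜ - a⟩` tends to zero. -/
theorem isVISolution_of_weakTendsto {p : Seminorm ℝ V} {A : V →ₗ[ℝ] StrongDual ℝ V}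
    (hAcont : Continuous A) (hA : IsSemicoercive p A) {g : StrongDual ℝ V} {K : Set V}
    {φ : V → V → ℝ} (hdiag : ∀ a ∈ K, φ a a = 0) {Kt : T → Set V} (hKt0 : ∀ t, (0 : V) ∈ Kt t)
    {φt : T → V → V → ℝ} (hlimsup : MoscoLimsup Kt K) (hliminf : MoscoLiminf Kt K)
    (hφt : BifunctionLimsup Kt φt φ) {F : Filter T} [F.NeBot] (hF : F ≤ atTop) {x : T → V} {R : ℝ}
    (hx : ∀ᶠ t in F, IsVISolution A (φt t) g (Kt t) (x t)) (hxR : ∀ᶠ t in F, ‖x t‖ ≤ R) {a : V}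
    (hxa : WeakTendsto x F a) :
    IsVISolution A φ g K a ∧ Tendsto (fun t => p (x t - a)) F (𝓝 0) := by
  obtain ⟨c₀, hc₀, hcoer⟩ := hA
  have hpos : ∀ w, 0 ≤ A w w := fun w => (mul_nonneg hc₀.le (sq_nonneg _)).trans (hcoer w)
  have hxK : ∀ᶠ t in F, x t ∈ Kt t := hx.mono fun t ht => ht.1
  have ha : a ∈ K := hlimsup.mem_of_weakTendsto hKt0 (h := id) hF hxK hxa
  have hweak := weakTendsto_iff.1 hxa
  let A' : V →L[ℝ] StrongDual ℝ V := ⟨A, hAcont⟩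
  -- `⟨A x, w⟩` is weakly continuous in `x`
  have hAw : ∀ w, Tendsto (fun t => A (x t) w) F (𝓝 (A a w)) := fun w => hweak (A'.flip w)
  have hexp : ∀ t, A (x t - a) (x t - a) = A (x t) (x t) - A (x t) a - A a (x t) + A a a := by
    intro t
    rw [A.map_sub, map_sub]
    simp
    ring
  have hupper : ∀ w ∈ K, ∀ ε > 0,
      ∀ᶠ t in F, A (x t) (x t) < A a w + φ a w - g w + g a + ε := by
    intro w hw ε hε
    obtain ⟨y, hyK, hyw⟩ := hliminf w hw
    have hyw := hyw.mono_left hF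
    have h1 : Tendsto (fun t => A (x t) (y t)) F (𝓝 (A a w)) := by
      have h0 : Tendsto (fun t => A (x t) (y t - w)) F (𝓝 0) := by
        have hz : Tendsto (fun t => ‖A'‖ * R * ‖y t - w‖) F (𝓝 0) := by
          have := ((hyw.sub_const w).norm).const_mul (‖A'‖ * R)
          simpa using this
        refine squeeze_zero_norm' ?_ hz
        filter_upwards [hxR] with t ht
        refine (A'.le_opNorm₂ (x t) (y t - w)).trans ?_
        gcongr
      have := h0.add (hAw w)
      simpa using this
    have h2 : ∀ᶠ t in F, φt t (x t) (y t) < φ a w + ε / 2 :=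
      hφt.eventually_lt hKt0 (h := id) hF hxK hyK hxa hyw (by linarith)
    have h3 : Tendsto (fun t => A (x t) (y t) - g (y t) + g (x t)) F
        (𝓝 (A a w - g w + g a)) :=
      (h1.sub ((g.continuous.tendsto w).comp hyw)).add (hweak g)
    have h4 := h3.eventually_lt_const (show _ < A a w - g w + g a + ε / 2 by linarith)
    filter_upwards [hx, h2, h4] with t ht h2 h4
    have h5 := ht.2 (y t) (hyK t)
    simp only [map_sub] at h5
    linarith
  have hlower : Tendsto (fun t => A (x t) a + A a (x t) - A a a) F (𝓝 (A a a)) := by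
    have := ((hAw a).add (hweak (A a))).sub_const (A a a)
    simpa using this
  refine ⟨⟨ha, fun w hw => ?_⟩, ?_⟩
  · have : A a a ≤ A a w + φ a w - g w + g a := by
      refine le_of_forall_pos_le_add fun ε hε => ?_
      refine le_of_tendsto hlower ?_
      filter_upwards [hupper w hw ε hε] with t ht
      linarith [hexp t, hpos (x t - a)]
    simp only [map_sub]
    linarith
  · have hquad : Tendsto (fun t => A (x t - a) (x t - a)) F (𝓝 0) := by
      refine tendsto_order.2 ⟨fun b hb => Eventually.of_forall fun t => hb.trans_le (hpos _),
        fun b hb => ?_⟩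
      have h1 := hupper a ha (b / 2) (half_pos hb)
      have h2 := hlower.eventually_const_lt (show A a a - b / 2 < _ by linarith)
      filter_upwards [h1, h2] with t h1 h2
      rw [hdiag a ha] at h1
      linarith [hexp t]
    have h0 := hquad.div_const c₀
    rw [zero_div] at h0
    have h1 : Tendsto (fun t => p (x t - a) ^ 2) F (𝓝 0) := by
      refine squeeze_zero (fun t => sq_nonneg _) (fun t => ?_) h0
      rw [le_div_iff₀ hc₀, mul_comm]
      exact hcoer _
    have h2 := (Real.continuous_sqrt.tendsto 0).comp h1
    rw [Real.sqrt_zero] at h2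
    exact h2.congr fun t => Real.sqrt_sq (apply_nonneg p _)

variable [CompleteSpace V] [IsDirectedOrder T] [Nonempty T]

/-- An unbounded net of points with `⟨A a, a⟩ ≤ ⟨g, a⟩ + c ‖a‖` would, once normalized, converge in
norm to a unit vector `y` of the kernel of `p` such that the ray through `y` lies in `K` and
`⟨g, y⟩ ≥ -c`. -/
theorem exists_norm_le_of_apply_self_le (hV : IsReflexiveSpace V) {p : Seminorm ℝ V}
    (hp : Continuous p) {A : V →ₗ[ℝ] StrongDual ℝ V} (hA : IsSemicoercive p A)
    {g : StrongDual ℝ V} {K : Set V} {c : ℝ} (hA1 : SeminormCompactness p)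
    (hA2 : RecessionCondition p K g c) {Kt : T → Set V} (hKtc : ∀ t, Convex ℝ (Kt t))
    (hKt0 : ∀ t, (0 : V) ∈ Kt t) (hK : MoscoLimsup Kt K) :
    ∃ (t₀ : T) (R : ℝ), ∀ t, t₀ ≤ t → ∀ a ∈ Kt t, A a a ≤ g a + c * ‖a‖ → ‖a‖ ≤ R := by
  by_contra! hno
  obtain ⟨c₀, hc₀, hcoer⟩ := hA
  choose t ht a haK haA haR using fun j : T × ℕ => hno j.1 j.2
  have : (atTop : Filter (T × ℕ)).NeBot := by
    rw [← prod_atTop_atTop_eq]; infer_instance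
  let U : Ultrafilter (T × ℕ) := Ultrafilter.of atTop
  have hU : (U : Filter (T × ℕ)) ≤ atTop := Ultrafilter.of_le _
  have hfst : Tendsto (Prod.fst : T × ℕ → T) U atTop := by
    refine Tendsto.mono_left ?_ hU
    rw [← prod_atTop_atTop_eq]; exact tendsto_fst
  have hsnd : Tendsto (fun j : T × ℕ => (j.2 : ℝ)) U atTop := by
    refine Tendsto.mono_left ?_ hU
    rw [← prod_atTop_atTop_eq]; exact tendsto_natCast_atTop_atTop.comp tendsto_snd
  have htT : Tendsto t U atTop := tendsto_atTop_mono ht hfst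
  have hnorm : Tendsto (fun j => ‖a j‖) U atTop := tendsto_atTop_mono (fun j => (haR j).le) hsnd
  have hpos : ∀ j, 0 < ‖a j‖ := fun j => (Nat.cast_nonneg _).trans_lt (haR j)
  let y : T × ℕ → V := fun j => ‖a j‖⁻¹ • a j
  have hy1 : ∀ j, ‖y j‖ = 1 := fun j => by
    simp only [y]
    rw [norm_smul, norm_inv, norm_norm, inv_mul_cancel₀ (hpos j).ne']
  have hgy : ∀ j, -c ≤ g (y j) := fun j => by
    have h1 : 0 ≤ g (a j) + c * ‖a j‖ :=
      (mul_nonneg hc₀.le (sq_nonneg _)).trans ((hcoer _).trans (haA j))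
    have h2 : g (y j) = g (a j) / ‖a j‖ := by
      simp only [y, map_smul, smul_eq_mul]
      rw [inv_mul_eq_div]
    rw [h2, le_div_iff₀ (hpos j)]
    linarith
  have hpy : ∀ j, p (y j) ^ 2 ≤ (‖g‖ + c) / c₀ / ‖a j‖ := fun j => by
    have h1 : c₀ * p (a j) ^ 2 ≤ (‖g‖ + c) * ‖a j‖ := by
      have := (le_abs_self _).trans (g.le_opNorm (a j))
      linarith [hcoer (a j), haA j]
    have h2 : p (y j) = p (a j) / ‖a j‖ := by
      simp only [y]
      rw [map_smul_eq_mul, norm_inv, norm_norm, inv_mul_eq_div]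
    rw [h2, div_pow, div_div, div_le_div_iff₀ (pow_pos (hpos j) 2) (mul_pos hc₀ (hpos j))]
    have := mul_le_mul_of_nonneg_right h1 (hpos j).le
    linarith
  have hpy0 : Tendsto (fun j => p (y j)) U (𝓝 0) := by
    have h1 : Tendsto (fun j => p (y j) ^ 2) U (𝓝 0) :=
      squeeze_zero (fun j => sq_nonneg _) hpy (tendsto_const_nhds.div_atTop hnorm)
    have h2 := (Real.continuous_sqrt.tendsto 0).comp h1
    rw [Real.sqrt_zero] at h2
    exact h2.congr fun j => Real.sqrt_sq (apply_nonneg p _)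
  obtain ⟨b, hb⟩ := hA1.exists_tendsto_ultrafilter hV U (x := y) (R := 1)
    (Eventually.of_forall fun j => (hy1 j).le) hpy0
  have hb1 : ‖b‖ = 1 :=
    tendsto_nhds_unique hb.norm (tendsto_const_nhds.congr fun j => (hy1 j).symm)
  have hpb : p b = 0 := tendsto_nhds_unique ((hp.tendsto b).comp hb) hpy0
  have hgb : -c ≤ g b := ge_of_tendsto' ((g.continuous.tendsto b).comp hb) hgy
  have hray : ∀ s : ℝ, 0 ≤ s → s • b ∈ K := by
    intro s hs
    refine hK.mem_of_weakTendsto hKt0 htT (x := fun j => s • y j) ?_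
      (WeakTendsto.of_tendsto (hb.const_smul s))
    filter_upwards [hnorm.eventually_ge_atTop s] with j hj
    have h1 : s • y j = (s / ‖a j‖) • a j := by
      simp only [y]
      rw [smul_smul, div_eq_mul_inv]
    rw [h1]
    exact (hKtc _).smul_mem_of_zero_mem (hKt0 _) (haK j)
      ⟨by positivity, (div_le_one (hpos j)).2 hj⟩
  rcases hA2 with hbdd | hstrict
  · obtain ⟨C, hC⟩ := hbdd.exists_norm_le
    have hmem : (|C| + 1) • b ∈ seminormKer p ∩ K := by
      refine ⟨?_, hray _ (by positivity)⟩
      change p _ = 0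
      rw [map_smul_eq_mul, hpb, mul_zero]
    have := hC _ hmem
    rw [norm_smul, hb1, mul_one, Real.norm_of_nonneg (by positivity)] at this
    linarith [le_abs_self C]
  · have := hstrict b ⟨hpb, by simpa using hray 1 zero_le_one⟩ hb1
    linarith

end VI

theorem theorem2
    {V : Type v} [NormedAddCommGroup V] [NormedSpace ℝ V] [CompleteSpace V]
    (hV : IsReflexiveSpace V)
    -- the seminorm and the semicoercive linear operator
    (p : Seminorm ℝ V) (hp : LowerSemicontinuous (fun w : V => p w))
    (A : V →ₗ[ℝ] StrongDual ℝ V) (hA : IsSemicoercive p A)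
    (g : StrongDual ℝ V)
    -- the limit problem
    (K : Set V) (hKclosed : IsClosed K) (hKconvex : Convex ℝ K) (hK0 : (0 : V) ∈ K)
    (φ : V → V → ℝ) (c : ℝ) (hc : 0 < c)
    (hφ : IsAdmissibleBifunction K φ c) (hφdiag : ∀ a ∈ K, φ a a = 0)
    (hA1 : SeminormCompactness p)
    (hA2 : RecessionCondition p K g c)
    -- the approximate problems
    {T : Type u} [Preorder T] [IsDirectedOrder T] [Nonempty T]
    (Vt : T → Submodule ℝ V) (hVt : ∀ t, FiniteDimensional ℝ (Vt t))
    (Kt : T → Set V) (hKtVt : ∀ t, Kt t ⊆ (Vt t : Set V))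
    (hKtclosed : ∀ t, IsClosed (Kt t)) (hKtconvex : ∀ t, Convex ℝ (Kt t))
    (hKt0 : ∀ t, (0 : V) ∈ Kt t)
    (φt : T → V → V → ℝ)
    (hH1 : MoscoLimsup Kt K)
    (hH2 : MoscoLiminf Kt K)
    (hH3 : ∀ t, IsAdmissibleBifunction (Kt t) (φt t) c)
    (hH4 : BifunctionLimsup Kt φt φ) :
    -- solvability of the approximate problems (bifunctions convex in the second variable and
    -- vanishing on the diagonal)
    ((∀ t, ∀ a ∈ Kt t, ConvexOn ℝ (Kt t) (φt t a) ∧ φt t a a = 0) →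
      ∃ t₀ : T, ∀ t, t₀ ≤ t → ∃ a : V, IsVISolution A (φt t) g (Kt t) a) ∧
    -- uniform boundedness of the approximate solutions
    (∃ (t₀ : T) (R : ℝ), ∀ t, t₀ ≤ t →
      ∀ a : V, IsVISolution A (φt t) g (Kt t) a → ‖a‖ ≤ R) ∧
    -- convergence of a subnet of any family of approximate solutions
    (∀ x : T → V, (∃ t₀ : T, ∀ t, t₀ ≤ t → IsVISolution A (φt t) g (Kt t) (x t)) →
      ∃ (T' : Type u) (_ : Preorder T') (_ : IsDirectedOrder T') (_ : Nonempty T') (h : T' → T)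
        (a : V), Tendsto h atTop atTop ∧ IsVISolution A φ g K a ∧
          WeakTendsto (fun s => x (h s)) atTop a ∧
          Tendsto (fun s => p (x (h s) - a)) atTop (𝓝 0)) := by
  have hpcont : Continuous p := Seminorm.continuous_of_lowerSemicontinuous p hp
  have hAcont : Continuous A := by
    obtain ⟨c₀, hc₀, hcoer⟩ := hA
    exact A.continuous_of_forall_apply_self_nonneg fun w =>
      (mul_nonneg hc₀.le (sq_nonneg _)).trans (hcoer w)
  obtain ⟨t₀, R, hR⟩ := exists_norm_le_of_apply_self_le hV hpcont hA hA1 hA2 hKtconvex hKt0 hH1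
  have hbound : ∀ t, t₀ ≤ t → ∀ a, IsVISolution A (φt t) g (Kt t) a → ‖a‖ ≤ R := fun t ht a ha =>
    hR t ht a ha.1 (ha.apply_self_le (hKt0 t) (hH3 t).growth)
  refine ⟨fun hconv => ⟨t₀, fun t ht => ?_⟩, ⟨t₀, R, hbound⟩, fun x hx => ?_⟩
  · have := hVt t
    refine exists_isVISolution_of_finiteDimensional hAcont (Vt t) (hKtVt t) (hKtclosed t)
      (hKtconvex t) (hKt0 t) (fun w hw => ?_) (hH3 t).growth (fun a ha => (hconv t a ha).1)
      (fun a ha => (hconv t a ha).2) (hR t ht)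
    have h := (hH3 t).usc w hw (Vt t) (hVt t)
    rwa [Set.inter_eq_left.2 (hKtVt t)] at h
  · obtain ⟨t₁, hx⟩ := hx
    let U : Ultrafilter T := Ultrafilter.of atTop
    have hU : (U : Filter T) ≤ atTop := Ultrafilter.of_le _
    have hxU : ∀ᶠ t in (U : Filter T), IsVISolution A (φt t) g (Kt t) (x t) :=
      hU ((eventually_ge_atTop t₁).mono hx)
    have hxR : ∀ᶠ t in (U : Filter T), ‖x t‖ ≤ R := by
      filter_upwards [hxU, hU (eventually_ge_atTop t₀)] with t h1 h2
      exact hbound t h2 _ h1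
    obtain ⟨a, ha⟩ := hV.exists_weakTendsto_ultrafilter U hxR
    obtain ⟨hsol, hlim⟩ := isVISolution_of_weakTendsto hAcont hA hφdiag hKt0 hH1 hH2 hH4 hU hxU
      hxR ha
    obtain ⟨T', _, hdir, hne, k, hk⟩ := exists_net_map_atTop_eq (U : Filter T)
    have hkU : Tendsto k atTop U := hk.le
    exact ⟨T', _, hdir, hne, k, a, hkU.mono_right hU, hsol, ha.comp hkU, hlim.comp hkU⟩
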